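/- **Terms.** Let $\Sigma$ be a probabilistically lifted signature with sorts $s$ (states) and $d$ (distributions): it has a set $F$ of state operators $f:\sigma_1\cdots\sigma_n\to s$ ($n\in\mathbb N$, $\sigma_i\in\{s,d\}$); for each $f\in F$ of rank $n$ its lifting $\mathbf f:d^n\to d$; possibly $\delta:s\to d$; and any family of operators $\bigoplus_{i\in I}[p_i]\_:d^{I}\to d$ with $I$ countable, $p_i\in(0,1]$ and $\sum_i p_i=1$. Open terms are built over disjoint infinite sets $\mathcal V$ of state variables and $\mathcal V_d$ of distribution variables; $\mathcal V(\xi)$ is the set of variables occurring in $\xi$. A closed distribution term $\theta$ denotes a discrete probability distribution $[\![\theta]\!]$ on closed state terms: $[\![\delta(t)]\!]$ is the Dirac distribution at $t$; $[\![\bigoplus_i[p_i]\theta_i]\!]=\sum_i p_i[\![\theta_i]\!]$; and $[\![\mathbf f(\theta_1,\dots,\theta_n)]\!](f(\xi_1,\dots,\xi_n))=\prod_{\sigma_i=s}[\![\theta_i]\!](\xi_i)$ if $\xi_j=\theta_j$ whenever $\sigma_j=d$, all other values being $0$. **Specifications.** A PTSS $P$ is a set of rules, each with an arbitrary set of premises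 of the forms $t\xrightarrow{a}\theta$, $t\not\xrightarrow{a}$, $\theta(T)\bowtie q$ ($T$ a set of open state terms, $\bowtie\in\{>,\ge,<,\le\}$, $q\in[0,1]$), and a conclusion $t\xrightarrow{a}\theta$, with labels $a$ from a set $A$. Rules are instantiated only by closed substitutions $\rho$ that are proper: $[\![\rho(\theta)]\!](\rho(t))>0$ for each quantitative premise $\theta(T)\bowtie q$ and each $t\in T$. For a set $N$ of closed negative literals, $P\vdash\frac N\psi$ means that $\psi$ is the root of a well-founded proof tree whose nodes are hypotheses in $N$, quantitative literals $\theta(T)\bowtie q$ with $[\![\theta]\!](T)\bowtie q$, or conclusions of rule instances whose premises are the nodes directly above. For a relation $Tr$ on (closed state terms) $\times A\times$ (closed distribution terms), $t\not\xrightarrow{a}$ holds in $Tr$ if $t\xrightarrow{a}\theta$ is in $Tr$ for no $\theta$. A pair $CT\subseteq PT$ of such relations is a 3-valued stable model of $P$ if for each closed $\psi=(t\xrightarrow{a}\theta)$: $\psi\in CT$ iff $P\vdash\frac N\psi$ for some $N$ all of whose members hold in $PT$; and $\psi\in PT$ iff $P\vdash\frac N\psi$ for some $N$ all of whose members hold in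 $CT$. $P$ is complete if its least 3-valued stable model (least $CT$, greatest $PT$) has $CT=PT$; then $t\xrightarrow{a}\pi$ means that $t\xrightarrow{a}\theta\in CT$ for some $\theta$ with $[\![\theta]\!]=\pi$. $P$ is well-founded if for each rule $r$ the graph on $\mathcal V\cup\mathcal V_d$ with the edges $(\zeta,\mu)$ for each premise $t\xrightarrow{a}\mu$ and $\zeta\in\mathcal V(t)$, and $(\zeta,y)$ for each premise $\theta(T)\bowtie q$, $\zeta\in\mathcal V(\theta)$ and variable $y\in T$, has no infinite backward chain. **Format.** A rule is in nt$\mu$f$\theta$ (respectively nt$\mu$x$\theta$) format if its conclusion is $f(\zeta_1,\dots,\zeta_n)\xrightarrow{a}\theta$ with $f\in F$ and pairwise different variables $\zeta_i$; put $B=\{\zeta_1,\dots,\zeta_n\}$ (respectively $x\xrightarrow{a}\theta$ with $x\in\mathcal V$; put $B=\{x\}$), and its set of premises is $$\{t_m(\vec z)\xrightarrow{a_m}\mu_m^{\vec z}\mid m\in M,\vec z\in\mathcal Z\}\cup\{t_n(\vec z)\not\xrightarrow{b_n}\mid n\in N,\vec z\in\mathcal Z\}\cup\{\theta_l(Y_l)\trianglerighteq_{l,k}p_{l,k}\mid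 l\in L,k\in K_l\},$$ where ${\trianglerighteq_{l,k}}\in\{>,\ge\}$ and $p_{l,k}\in[0,1]$; $Y_l\subseteq\mathcal V$; $\mathcal Z=D\times\prod_{\zeta\in W}\{\zeta\}$ for some $W\subseteq(\mathcal V\cup\mathcal V_d)\setminus\bigcup_lY_l$ and some $D\subseteq\prod_{l\in L}Y_l$ that projects onto every $Y_l$ and whose distinct elements differ in every coordinate; and $t(\vec z)$ is obtained from a term $t$, whose variables are formal parameters indexed by $L$ and $W$, by substituting the entries of $\vec z$. Moreover: (1) each $Y_l$ is infinite, and $|L|<|Y_l|$; (2) the variables $\mu_m^{\vec z}$ are different for different positive premises and are not in $B$; (3) the $Y_l$ are pairwise disjoint and disjoint from $B$; (4) for each $m\in M$, $\{\mu_m^{\vec z}\mid\vec z\in\mathcal Z\}\cap(\mathcal V(\theta)\cup\bigcup_l\mathcal V(\theta_l)\cup W)$ is finite; (5) for each $l\in L$, $Y_l\cap(\mathcal V(\theta)\cup\bigcup_{l'}\mathcal V(\theta_{l'}))$ is finite. $P$ is in probability abstracted nt$\mu$f$\theta$/nt$\mu$x$\theta$ format if each of its rules is in one of the two formats and $q=0$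 for every quantitative premise $\theta(T)\bowtie q$ of its rules. **Bisimilarity.** For a relation $R$ on closed state terms, a set $Q$ is $R$-closed if $t\in Q$ and $t\,R\,t'$ imply $t'\in Q$. Write $\pi\,\hat R\,\pi'$ if $\pi(Q)>0\iff\pi'(Q)>0$ for all $R$-closed $Q$. A symmetric $R$ is a probability abstracted bisimulation if $t\,R\,t'$ and $t\xrightarrow{a}\pi$ imply $t'\xrightarrow{a}\pi'$ and $\pi\,\hat R\,\pi'$ for some $\pi'$; probability abstracted bisimilarity $\sim_a$ is the union of all of these. Closed distribution terms are related, $\theta\sim_a\theta'$, if $[\![\theta]\!]\,\hat{\sim}_a\,[\![\theta']\!]$. **Theorem.** Let $P$ be a complete, well-founded PTSS in probability abstracted nt$\mu$f$\theta$/nt$\mu$x$\theta$ format. Then $\sim_a$ is a congruence: it is an equivalence relation on closed state terms, and for every operator $g$ of $\Sigma$ (state operator, lifting, $\delta$ or $\bigoplus$), if $\xi_i\sim_a\xi_i'$ for all arguments $i$, each related in its sort, then $g((\xi_i)_i)\sim_a g((\xi'_i)_i)$. -/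

import Mathlib

open scoped ENNReal

namespace SOS

universe u v w

/-! ## Two-sorted probabilistically lifted signatures and terms -/

/-- The two sorts: states (`st`) and distributions (`di`). -/
inductive Srt : Type
  | st
  | di

/-- A probabilistically lifted signature. `F` is the set of state operators, with finite arities
`argSort f 0, …, argSort f (rank f - 1) → st`. The distribution operators are the lifting of every
`f : F` (present automatically, see `Term.lift`), possibly `δ` (present iff `hasDelta`), and a
family `Oplus` of operators `⨁_{i ∈ I} [p_i] _`, each with a countable index set `idx o` and a family
of weights `p_i ∈ (0,1]` that sums up to one, that is, a probability mass function that vanishes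
nowhere. -/
structure Signature where
  F : Type u
  rank : F → ℕ
  argSort : ∀ f : F, Fin (rank f) → Srt
  hasDelta : Prop
  Oplus : Type u
  idx : Oplus → Type
  idx_countable : ∀ o, Countable (idx o)
  weight : ∀ o, PMF (idx o)
  weight_ne_zero : ∀ o i, weight o i ≠ 0

/-- Terms of each sort over the sorted family of variables `X`. -/
inductive Term (S : Signature.{u}) (X : Srt → Type v) : Srt → Type (max u v)
  | var {σ : Srt} (x : X σ) : Term S X σ
  | op (f : S.F) (ξ : ∀ i : Fin (S.rank f), Term S X (S.argSort f i)) : Term S X Srt.st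
  | lift (f : S.F) (θ : Fin (S.rank f) → Term S X Srt.di) : Term S X Srt.di
  | delta (h : S.hasDelta) (t : Term S X Srt.st) : Term S X Srt.di
  | oplus (o : S.Oplus) (θ : S.idx o → Term S X Srt.di) : Term S X Srt.di

/-- Closed terms: terms over the empty family of variables. -/
abbrev CTerm (S : Signature.{u}) (σ : Srt) : Type u := Term S (fun _ => Empty) σ

/-- Sort-preserving substitutions. -/
abbrev Subst (S : Signature.{u}) (X : Srt → Type v) (X' : Srt → Type w) :=
  ∀ σ : Srt, X σ → Term S X' σ

namespace Term

variable {S : Signature.{u}} {X : Srt → Type v} {X' : Srt → Type w}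

/-- Homomorphic extension of a substitution to terms. -/
def subst (ρ : Subst S X X') : ∀ {σ : Srt}, Term S X σ → Term S X' σ
  | _, var x => ρ _ x
  | _, op f ξ => op f (fun i => subst ρ (ξ i))
  | _, lift f θ => lift f (fun i => subst ρ (θ i))
  | _, delta h t => delta h (subst ρ t)
  | _, oplus o θ => oplus o (fun i => subst ρ (θ i))

/-- The set of variables (of both sorts) that occur in a term. -/
def vars : ∀ {σ : Srt}, Term S X σ → Set (Σ σ : Srt, X σ)
  | σ, var x => {⟨σ, x⟩}
  | _, op _ ξ => ⋃ i, vars (ξ i)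
  | _, lift _ θ => ⋃ i, vars (θ i)
  | _, delta _ t => vars t
  | _, oplus _ θ => ⋃ i, vars (θ i)

end Term

/-! ## The algebra of a signature -/

/-- The sum over a finite product of a product of masses is the product of the total masses. -/
theorem tsum_pi_prod : ∀ (n : ℕ) (α : Fin n → Type u) (g : ∀ i, α i → ℝ≥0∞),
    (∑' x : (∀ i, α i), ∏ i, g i (x i)) = ∏ i, ∑' a, g i a := by
  intro n
  induction n with
  | zero =>
    intro α g
    simp
  | succ n ih =>
    intro α g
    rw [← (Fin.consEquiv α).tsum_eq, ENNReal.tsum_prod', Fin.prod_univ_succ,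
      ← ih (fun i => α i.succ) (fun i => g i.succ), ← ENNReal.tsum_mul_right]
    refine tsum_congr fun a => ?_
    rw [← ENNReal.tsum_mul_left]
    refine tsum_congr fun b => ?_
    simp [Fin.prod_univ_succ, Fin.consEquiv]

/-- The independent product of finitely many discrete distributions. -/
noncomputable def pmfPi {n : ℕ} {α : Fin n → Type u} (π : ∀ i, PMF (α i)) : PMF (∀ i, α i) :=
  ⟨fun x => ∏ i, π i (x i), by
    have h : (∑' x : (∀ i, α i), ∏ i, π i (x i)) = 1 := by
      rw [tsum_pi_prod n α (fun i => π i)]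
      simp [PMF.tsum_coe]
    exact h ▸ ENNReal.summable.hasSum⟩

/-- The probability of a set under a discrete distribution. -/
noncomputable def prob {α : Type u} (π : PMF α) (Q : Set α) : ℝ≥0∞ := ∑' t : Q, π t

variable {S : Signature.{u}}

/-- The carriers: closed state terms, and discrete distributions over closed state terms. -/
def Carrier (S : Signature.{u}) : Srt → Type u
  | Srt.st => CTerm S Srt.st
  | Srt.di => PMF (CTerm S Srt.st)

/-- The distribution of the argument of `f` in a position of sort `σ`, when the corresponding
argument of the lifting of `f` is `θ` with meaning `π`: it is `π` in a state position, and in a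
distribution position it forces the argument to be syntactically equal to `θ`. -/
noncomputable def argDist (θ : CTerm S Srt.di) (π : PMF (CTerm S Srt.st)) :
    ∀ σ : Srt, PMF (CTerm S σ)
  | Srt.st => π
  | Srt.di => PMF.pure θ

/-- The interpretation of closed terms. -/
noncomputable def interp : ∀ {σ : Srt}, CTerm S σ → Carrier S σ
  | _, Term.var x => x.elim
  | _, Term.op f ξ => (Term.op f ξ : CTerm S Srt.st)
  | _, Term.lift f θ =>
      PMF.map (Term.op f)
        (pmfPi fun i => argDist (θ i) (interp (θ i) : PMF (CTerm S Srt.st)) (S.argSort f i))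
  | _, Term.delta _ t => (PMF.pure t : PMF (CTerm S Srt.st))
  | _, Term.oplus o θ =>
      (PMF.bind (S.weight o) fun i => (interp (θ i) : PMF (CTerm S Srt.st)))

/-- The distribution denoted by a closed distribution term. -/
noncomputable def sem (θ : CTerm S Srt.di) : PMF (CTerm S Srt.st) := interp θ

theorem sem_delta (h : S.hasDelta) (t : CTerm S Srt.st) :
    sem (Term.delta h t) = PMF.pure t := by
  simp [sem, interp]

theorem sem_oplus_apply (o : S.Oplus) (θ : S.idx o → CTerm S Srt.di) (t : CTerm S Srt.st) :
    sem (Term.oplus o θ) t = ∑' i, S.weight o i * sem (θ i) t := by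
  simp only [sem, interp]
  exact PMF.bind_apply _ _ _

theorem sem_lift_op (f : S.F) (θ : Fin (S.rank f) → CTerm S Srt.di)
    (ξ : ∀ i, CTerm S (S.argSort f i)) :
    sem (Term.lift f θ) (Term.op f ξ)
      = ∏ i, argDist (θ i) (sem (θ i)) (S.argSort f i) (ξ i) := by
  classical
  simp only [sem, interp, PMF.map_apply]
  rw [tsum_eq_single ξ]
  · simp [pmfPi]
    rfl
  · intro ξ' h
    rw [if_neg]
    intro h'
    injection h' with _ h2
    exact h h2.symm

theorem sem_lift_of_ne (f : S.F) (θ : Fin (S.rank f) → CTerm S Srt.di) (t : CTerm S Srt.st)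
    (h : ∀ ξ, t ≠ Term.op f ξ) : sem (Term.lift f θ) t = 0 := by
  classical
  simp only [sem, interp, PMF.map_apply]
  simp [h]

/-! ## Literals, rules and specifications -/

/-- The comparison symbols of quantitative literals. -/
inductive Cmp : Type
  | gt
  | ge
  | lt
  | le

/-- The meaning of a comparison symbol. -/
def Cmp.Holds : Cmp → ℝ≥0∞ → ℝ≥0∞ → Prop
  | Cmp.gt, p, q => p > q
  | Cmp.ge, p, q => p ≥ q
  | Cmp.lt, p, q => p < q
  | Cmp.le, p, q => p ≤ q

/-- The literals `t —a→ θ`, `t —a↛` and `θ(T) ⋈ q`. -/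
inductive Literal (S : Signature.{u}) (A : Type w) (X : Srt → Type v) : Type (max u v w)
  | pos (t : Term S X Srt.st) (a : A) (θ : Term S X Srt.di)
  | neg (t : Term S X Srt.st) (a : A)
  | quant (θ : Term S X Srt.di) (T : Set (Term S X Srt.st)) (c : Cmp) (q : unitInterval)

/-- Closed literals. -/
abbrev CLiteral (S : Signature.{u}) (A : Type w) := Literal S A (fun _ => Empty)

/-- Closed substitution in literals. -/
def Literal.close {A : Type w} {X : Srt → Type v} (ρ : Subst S X (fun _ => Empty)) :
    Literal S A X → CLiteral S A
  | .pos t a θ => .pos (t.subst ρ) a (θ.subst ρ)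
  | .neg t a => .neg (t.subst ρ) a
  | .quant θ T c q => .quant (θ.subst ρ) (Term.subst ρ '' T) c q

/-- A rule with a set of premises and the conclusion `src —act→ tgt`. -/
structure Rule (S : Signature.{u}) (A : Type w) (X : Srt → Type v) where
  prem : Set (Literal S A X)
  src : Term S X Srt.st
  act : A
  tgt : Term S X Srt.di

/-- A probabilistic transition system specification over the signature `S`, the labels `A` and the
variables `X`: a set of rules. -/
structure PTSS (S : Signature.{u}) (A : Type w) (X : Srt → Type v) where
  rules : Set (Rule S A X)

variable {A : Type w} {X : Srt → Type v}

/-- The closed substitution `ρ` is proper for `r`: for every quantitative premise `θ(T) ⋈ q`,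
every instance of an element of `T` has positive probability under the instance of `θ`. -/
def Rule.Proper (r : Rule S A X) (ρ : Subst S X (fun _ => Empty)) : Prop :=
  ∀ θ T c q, Literal.quant θ T c q ∈ r.prem →
    ∀ t ∈ T, 0 < sem (Term.subst ρ θ) (Term.subst ρ t)

/-- Symbolic transition relations. -/
abbrev TRel (S : Signature.{u}) (A : Type w) := CTerm S Srt.st → A → CTerm S Srt.di → Prop

/-- Provability of a closed literal from the set `H` of closed literals; the well-founded proof
trees are the derivations of this inductive predicate. -/
inductive PTSS.Provable (P : PTSS S A X) (H : Set (CLiteral S A)) : CLiteral S A → Prop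
  | hyp {χ : CLiteral S A} (h : χ ∈ H) : Provable P H χ
  | quant {θ : CTerm S Srt.di} {T : Set (CTerm S Srt.st)} {c : Cmp} {q : unitInterval}
      (h : c.Holds (prob (sem θ) T) (ENNReal.ofReal q)) : Provable P H (.quant θ T c q)
  | rule (r : Rule S A X) (hr : r ∈ P.rules) (ρ : Subst S X (fun _ => Empty)) (hρ : r.Proper ρ)
      (h : ∀ φ ∈ r.prem, Provable P H (φ.close ρ)) :
      Provable P H (.pos (r.src.subst ρ) r.act (r.tgt.subst ρ))

/-- `t —a→ θ` is provable from some set `N` of closed negative literals all of which hold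
in `Tr`. -/
def PTSS.Supported (P : PTSS S A X) (Tr : TRel S A) : TRel S A := fun t a θ =>
  ∃ N : Set (CTerm S Srt.st × A),
    P.Provable {φ | ∃ n ∈ N, φ = .neg n.1 n.2} (.pos t a θ) ∧
      ∀ n ∈ N, ∀ θ', ¬ Tr n.1 n.2 θ'

/-- `⟨CT, PT⟩` is a 3-valued stable model of `P`. -/
structure PTSS.IsStable (P : PTSS S A X) (CT PT : TRel S A) : Prop where
  certain_possible : ∀ t a θ, CT t a θ → PT t a θ
  certain_iff : ∀ t a θ, CT t a θ ↔ P.Supported PT t a θ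
  possible_iff : ∀ t a θ, PT t a θ ↔ P.Supported CT t a θ

/-- `⟨CT, PT⟩` is the least (that is, least informative) 3-valued stable model of `P`. -/
structure PTSS.IsLeastStable (P : PTSS S A X) (CT PT : TRel S A) : Prop where
  stable : P.IsStable CT PT
  least : ∀ CT' PT', P.IsStable CT' PT' →
    (∀ t a θ, CT t a θ → CT' t a θ) ∧ (∀ t a θ, PT' t a θ → PT t a θ)

/-- `P` is complete: its least 3-valued stable model is 2-valued. -/
def PTSS.Complete (P : PTSS S A X) : Prop :=
  ∃ CT PT, P.IsLeastStable CT PT ∧ CT = PT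

/-- The transition relation associated to a complete `P` (the certain transitions of the least
3-valued stable model, which is unique). -/
def PTSS.tr (P : PTSS S A X) : TRel S A := fun t a θ =>
  ∃ CT PT, P.IsLeastStable CT PT ∧ CT t a θ

/-- The transition relation of the probabilistic transition system associated to `P`. -/
def PTSS.trans (P : PTSS S A X) (t : CTerm S Srt.st) (a : A) (π : PMF (CTerm S Srt.st)) : Prop :=
  ∃ θ, P.tr t a θ ∧ sem θ = π

/-! ## Well-founded rules and the formats -/

/-- The edges of the dependency graph of a rule. -/
inductive Rule.Dep (r : Rule S A X) : (Σ σ : Srt, X σ) → (Σ σ : Srt, X σ) → Prop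
  | pos {t : Term S X Srt.st} {a : A} {μ : X Srt.di} {ζ : Σ σ : Srt, X σ}
      (h : Literal.pos t a (Term.var μ) ∈ r.prem) (hζ : ζ ∈ t.vars) : Rule.Dep r ζ ⟨Srt.di, μ⟩
  | quant {θ : Term S X Srt.di} {T : Set (Term S X Srt.st)} {c : Cmp} {q : unitInterval}
      {y : X Srt.st} {ζ : Σ σ : Srt, X σ}
      (h : Literal.quant θ T c q ∈ r.prem) (hy : Term.var y ∈ T) (hζ : ζ ∈ θ.vars) :
      Rule.Dep r ζ ⟨Srt.st, y⟩

/-- `P` is well-founded: no rule has an infinite backward chain in its dependency graph. -/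
def PTSS.WellFoundedRules (P : PTSS S A X) : Prop := ∀ r ∈ P.rules, WellFounded r.Dep

/-- The formal arguments of the term schemes `t(z)` with `z` in `Diag {Y_l} × ∏_{ζ ∈ W} {ζ}`: one
state-sorted argument for each `l : L`, and the variables in `W`. -/
inductive ZVar (L : Type v) (W : Set (Σ σ : Srt, X σ)) : Srt → Type v
  | coord (l : L) : ZVar L W Srt.st
  | fixed {σ : Srt} (x : X σ) (h : (⟨σ, x⟩ : Σ σ : Srt, X σ) ∈ W) : ZVar L W σ

/-- The substitution that turns `t` into `t(z)`: the argument for `l` is replaced by the variable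
`z l`, and each variable of `W` by itself. -/
def ZVar.inst (S : Signature.{u}) {L : Type v} {W : Set (Σ σ : Srt, X σ)} (z : L → X Srt.st) :
    Subst S (ZVar L W) X
  | _, .coord l => Term.var (z l)
  | _, .fixed x _ => Term.var x

/-- The shape and side conditions common to both kinds of rules of the format, for a rule whose
source has exactly the variables `B`. -/
structure Rule.Scheme (r : Rule S A X) (B : Set (Σ σ : Srt, X σ)) where
  /-- The index sets of the quantitative and of the positive premises. -/
  L : Type v
  M : Type v
  /-- The sets `Y_l`, a diagonal of them, and the set `W`. -/
  Y : L → Set (X Srt.st)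
  diag : Set (L → X Srt.st)
  W : Set (Σ σ : Srt, X σ)
  diag_mem : ∀ y ∈ diag, ∀ l, y l ∈ Y l
  diag_proj : ∀ l, ∀ x ∈ Y l, ∃ y ∈ diag, y l = x
  diag_inj : ∀ y ∈ diag, ∀ y' ∈ diag, (∃ l, y l = y' l) → y = y'
  W_disjoint : ∀ l, ∀ x ∈ Y l, (⟨Srt.st, x⟩ : Σ σ : Srt, X σ) ∉ W
  /-- The positive premises `t_m(z) —a_m→ μ_m^z`; only the values of `mu m` on `diag` matter. -/
  t : M → Term S (ZVar L W) Srt.st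
  a : M → A
  mu : M → (L → X Srt.st) → X Srt.di
  /-- The set of pairs `(t_n, b_n)` of the negative premises `t_n(z) —b_n↛`. -/
  negs : Set (Term S (ZVar L W) Srt.st × A)
  /-- The terms `θ_l`, and the sets of pairs `(⊵, p)` of the premises `θ_l(Y_l) ⊵ p`. -/
  theta : L → Term S X Srt.di
  bounds : L → Set (Cmp × unitInterval)
  bounds_lower : ∀ l, ∀ k ∈ bounds l, k.1 = Cmp.gt ∨ k.1 = Cmp.ge
  prem_eq : r.prem =
    {φ | ∃ m, ∃ z ∈ diag,
        φ = .pos ((t m).subst (ZVar.inst S z)) (a m) (Term.var (mu m z))} ∪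
    {φ | ∃ n ∈ negs, ∃ z ∈ diag, φ = .neg (n.1.subst (ZVar.inst S z)) n.2} ∪
    {φ | ∃ l, ∃ k ∈ bounds l, φ = .quant (theta l) (Term.var '' Y l) k.1 k.2}
  Y_infinite : ∀ l, (Y l).Infinite
  card_lt : ∀ l, Cardinal.mk L < Cardinal.mk (Y l)
  /-- Different positive premises have different target variables. -/
  mu_inj : ∀ m, ∀ z ∈ diag, ∀ m', ∀ z' ∈ diag, mu m z = mu m' z' →
    (t m).subst (ZVar.inst S z) = (t m').subst (ZVar.inst S z') ∧ a m = a m'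
  mu_not_source : ∀ m, ∀ z ∈ diag, (⟨Srt.di, mu m z⟩ : Σ σ : Srt, X σ) ∉ B
  Y_not_source : ∀ l, ∀ x ∈ Y l, (⟨Srt.st, x⟩ : Σ σ : Srt, X σ) ∉ B
  Y_disjoint : ∀ l l', l ≠ l' → Disjoint (Y l) (Y l')
  mu_finite : ∀ m, ({ζ | ∃ z ∈ diag, ζ = ⟨Srt.di, mu m z⟩} ∩
    (r.tgt.vars ∪ (⋃ l, (theta l).vars) ∪ W)).Finite
  Y_finite : ∀ l, ({ζ | ∃ x ∈ Y l, ζ = ⟨Srt.st, x⟩} ∩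
    (r.tgt.vars ∪ ⋃ l', (theta l').vars)).Finite

/-- `r` is in ntμfθ format: its source is `f(ζ₁, …, ζₙ)` with pairwise different variables. -/
def Rule.InNtmuf (r : Rule S A X) : Prop :=
  ∃ (f : S.F) (ζ : ∀ i, X (S.argSort f i)),
    Function.Injective (fun i => (⟨S.argSort f i, ζ i⟩ : Σ σ : Srt, X σ)) ∧
    r.src = Term.op f (fun i => Term.var (ζ i)) ∧
    Nonempty (r.Scheme (Set.range fun i => ⟨S.argSort f i, ζ i⟩))

/-- `r` is in ntμxθ format: its source is a variable. -/
def Rule.InNtmux (r : Rule S A X) : Prop :=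
  ∃ x : X Srt.st, r.src = Term.var x ∧ Nonempty (r.Scheme {⟨Srt.st, x⟩})

/-- `P` is in ntμfθ/ntμxθ format. -/
def PTSS.InFormat (P : PTSS S A X) : Prop := ∀ r ∈ P.rules, r.InNtmuf ∨ r.InNtmux

/-- `P` is in probability abstracted ntμfθ/ntμxθ format. -/
def PTSS.InAbstractedFormat (P : PTSS S A X) : Prop :=
  P.InFormat ∧ ∀ r ∈ P.rules, ∀ θ T c q, Literal.quant θ T c q ∈ r.prem → q = 0

/-! ## Probability abstracted bisimilarity and congruences -/

/-- `Q` is closed under `R`. -/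
def RClosed {α : Type u} (R : α → α → Prop) (Q : Set α) : Prop :=
  ∀ t ∈ Q, ∀ t', R t t' → t' ∈ Q

/-- `π` and `π'` give positive probability to the same `R`-closed sets. -/
def AbsLift {α : Type u} (R : α → α → Prop) (π π' : PMF α) : Prop :=
  ∀ Q : Set α, RClosed R Q → (0 < prob π Q ↔ 0 < prob π' Q)

/-- `R` is a probability abstracted bisimulation. -/
def IsAbsBisimulation {α : Type u} {A : Type w} (trans : α → A → PMF α → Prop)
    (R : α → α → Prop) : Prop :=
  (∀ t t', R t t' → R t' t) ∧
    ∀ t t' a π, R t t' → trans t a π → ∃ π', trans t' a π' ∧ AbsLift R π π'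

/-- Probability abstracted bisimilarity: the union of all probability abstracted bisimulations. -/
def AbsBisimilar {α : Type u} {A : Type w} (trans : α → A → PMF α → Prop) (t t' : α) : Prop :=
  ∃ R, IsAbsBisimulation trans R ∧ R t t'

/-- Probability abstracted bisimilarity on the closed state terms of `P`. -/
def PTSS.absBisim (P : PTSS S A X) : CTerm S Srt.st → CTerm S Srt.st → Prop :=
  AbsBisimilar P.trans

/-- The extension of a relation on closed state terms to closed terms of both sorts: distribution
terms are related if the distributions they denote are. -/
def SortRel (R : CTerm S Srt.st → CTerm S Srt.st → Prop) :
    ∀ σ : Srt, CTerm S σ → CTerm S σ → Prop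
  | Srt.st, t, t' => R t t'
  | Srt.di, θ, θ' => AbsLift R (sem θ) (sem θ')

/-- `R` is an equivalence relation and it is preserved by every operator of the signature: the
state operators, and also their liftings, `δ` and the operators `⨁`. -/
structure IsCongruence (R : CTerm S Srt.st → CTerm S Srt.st → Prop) : Prop where
  equiv : Equivalence R
  op : ∀ (f : S.F) (ξ ξ' : ∀ i, CTerm S (S.argSort f i)),
    (∀ i, SortRel R (S.argSort f i) (ξ i) (ξ' i)) → R (Term.op f ξ) (Term.op f ξ')
  lift : ∀ (f : S.F) (θ θ' : Fin (S.rank f) → CTerm S Srt.di),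
    (∀ i, SortRel R Srt.di (θ i) (θ' i)) → SortRel R Srt.di (Term.lift f θ) (Term.lift f θ')
  delta : ∀ (h : S.hasDelta) (t t' : CTerm S Srt.st),
    R t t' → SortRel R Srt.di (Term.delta h t) (Term.delta h t')
  oplus : ∀ (o : S.Oplus) (θ θ' : S.idx o → CTerm S Srt.di),
    (∀ i, SortRel R Srt.di (θ i) (θ' i)) → SortRel R Srt.di (Term.oplus o θ) (Term.oplus o θ')

end SOS

/-! Close bisimilarity under the state operators, relating two distribution terms when every point
of either support is matched by a related point of the other (`OpClosure`). This closure is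
respected by liftings, `δ` and `⨁` too, hence by substitution, because the support of a compound
distribution is determined by the supports of its arguments. For an equivalence relation, matching
of supports is the same as giving positive probability to the same closed sets. So once the closure
is shown to be a bisimulation, it coincides with bisimilarity at both sorts, and congruence follows.

The core is to transfer a transition `t —a→ θ` to any `t'` related to `t` by the closure
(`PTSS.tr_transfer`). Completeness makes the transition relation both the least fixed point of
`supportedTwice` and a fixed point of the antitone `Supported`. Induction on the least fixed point
handles negative premises: approximations `C` from below and `Supported C` from above control each
other. Within one stage, `PTSS.supported_transfer` is an induction on proof trees.

For a single rule instance (`Rule.Scheme.transfer`), a new substitution is built along the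
well-founded dependency graph. Targets of positive premises get values by the induction hypothesis.
A variable of `Y_l` had a value in the support of the old instance of `θ_l`, so it receives a
matching point in the support of the new one. The new substitution is therefore proper, and
properness already yields the quantitative premises, since their bounds are 0. -/

namespace SOS

universe u v w

/-! ## Supports of discrete distributions and the lifting of relations -/

section Support

variable {α : Type u}

theorem prob_pos_iff (π : PMF α) (Q : Set α) : 0 < prob π Q ↔ ∃ t ∈ Q, π t ≠ 0 := by
  rw [pos_iff_ne_zero, prob, Ne, ENNReal.tsum_eq_zero]
  simp

/-- Every element of the support of `π` is related to an element of the support of `π'`. -/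
def SuppSim (R : α → α → Prop) (π π' : PMF α) : Prop :=
  ∀ t, π t ≠ 0 → ∃ t', π' t' ≠ 0 ∧ R t t'

theorem SuppSim.mono {R R' : α → α → Prop} (h : ∀ t t', R t t' → R' t t') {π π' : PMF α}
    (hs : SuppSim R π π') : SuppSim R' π π' := fun t ht =>
  let ⟨t', h1, h2⟩ := hs t ht
  ⟨t', h1, h t t' h2⟩

theorem SuppSim.absLift {R : α → α → Prop} {π π' : PMF α} (h : SuppSim R π π')
    (h' : SuppSim R π' π) : AbsLift R π π' := by
  intro Q hQ
  rw [prob_pos_iff, prob_pos_iff]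
  constructor
  · rintro ⟨t, ht, hp⟩
    obtain ⟨t', hp', hr⟩ := h t hp
    exact ⟨t', hQ t ht t' hr, hp'⟩
  · rintro ⟨t, ht, hp⟩
    obtain ⟨t', hp', hr⟩ := h' t hp
    exact ⟨t', hQ t ht t' hr, hp'⟩

theorem AbsLift.symm {R : α → α → Prop} {π π' : PMF α} (h : AbsLift R π π') : AbsLift R π' π :=
  fun Q hQ => (h Q hQ).symm

theorem AbsLift.trans {R : α → α → Prop} {π π' π'' : PMF α} (h : AbsLift R π π')
    (h' : AbsLift R π' π'') : AbsLift R π π'' :=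
  fun Q hQ => (h Q hQ).trans (h' Q hQ)

/-- A larger relation has fewer closed sets to test. -/
theorem AbsLift.mono {R R' : α → α → Prop} (h : ∀ t t', R t t' → R' t t') {π π' : PMF α}
    (hl : AbsLift R π π') : AbsLift R' π π' :=
  fun Q hQ => hl Q fun t ht t' hr => hQ t ht t' (h t t' hr)

/-- Test the two distributions on the equivalence class of a point of the support. -/
theorem AbsLift.suppSim {R : α → α → Prop} (hR : Equivalence R) {π π' : PMF α}
    (h : AbsLift R π π') : SuppSim R π π' := by
  intro t ht
  have hQ : RClosed R {u | R t u} := fun u hu u' huu' => hR.trans hu huu'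
  have := (h _ hQ).1 ((prob_pos_iff _ _).2 ⟨t, hR.refl t, ht⟩)
  obtain ⟨t', h1, h2⟩ := (prob_pos_iff _ _).1 this
  exact ⟨t', h2, h1⟩

end Support

/-! ## Probability abstracted bisimilarity -/

section Bisimilarity

variable {α : Type u} {A : Type w} {trans : α → A → PMF α → Prop}

theorem AbsBisimilar.symm {t t' : α} (h : AbsBisimilar trans t t') : AbsBisimilar trans t' t :=
  let ⟨R, hR, h⟩ := h
  ⟨R, hR, hR.1 _ _ h⟩

theorem isAbsBisimulation_absBisimilar : IsAbsBisimulation trans (AbsBisimilar trans) := by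
  refine ⟨fun _ _ h => h.symm, ?_⟩
  rintro t t' a π ⟨R, hR, h⟩ hπ
  obtain ⟨π', h1, h2⟩ := hR.2 t t' a π h hπ
  exact ⟨π', h1, h2.mono fun t t' h => ⟨R, hR, h⟩⟩

theorem absBisimilar_equivalence : Equivalence (AbsBisimilar trans) := by
  refine ⟨fun t => ⟨Eq, ⟨fun _ _ h => h.symm, ?_⟩, rfl⟩, AbsBisimilar.symm, ?_⟩
  · rintro t _ a π rfl hπ
    exact ⟨π, hπ, fun _ _ => Iff.rfl⟩
  · intro x y z hxy hyz
    -- The transitive closure of bisimilarity is again symmetric, and chaining transfers along a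
    -- path shows that it is a bisimulation.
    refine ⟨Relation.TransGen (AbsBisimilar trans), ⟨?_, ?_⟩, .tail (.single hxy) hyz⟩
    · intro t t' h
      have : Std.Symm (AbsBisimilar trans) := ⟨fun _ _ h => h.symm⟩
      exact Relation.TransGen.stdSymm.symm _ _ h
    · intro t t' a π h
      induction h with
      | single h =>
        intro hπ
        obtain ⟨π', h1, h2⟩ := isAbsBisimulation_absBisimilar.2 _ _ a π h hπ
        exact ⟨π', h1, h2.mono fun _ _ => .single⟩
      | tail _ h ih =>
        intro hπ
        obtain ⟨π', h1, h2⟩ := ih hπ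
        obtain ⟨π'', h3, h4⟩ := isAbsBisimulation_absBisimilar.2 _ _ a π' h h1
        exact ⟨π'', h3, h2.trans (h4.mono fun _ _ => .single)⟩

end Bisimilarity

/-! ## Closure of a relation under the operators -/

section Closure

variable {S : Signature.{u}}

/-- The least relation on closed terms that contains `B` on state terms, is preserved by the state
operators, and relates distribution terms whose supports match. -/
inductive OpClosure (B : CTerm S Srt.st → CTerm S Srt.st → Prop) :
    ∀ σ : Srt, CTerm S σ → CTerm S σ → Prop
  | base {t t' : CTerm S Srt.st} (h : B t t') : OpClosure B Srt.st t t'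
  | op (f : S.F) (ξ ξ' : ∀ i, CTerm S (S.argSort f i))
      (h : ∀ i, OpClosure B (S.argSort f i) (ξ i) (ξ' i)) :
      OpClosure B Srt.st (Term.op f ξ) (Term.op f ξ')
  -- Explicit matching functions `g`, `g'` take the place of existential quantifiers, so that the
  -- recursive occurrences are plain premises. Matching of supports is used rather than `AbsLift`
  -- because the closure is not known to be transitive.
  | dist (θ θ' : CTerm S Srt.di) (g g' : CTerm S Srt.st → CTerm S Srt.st)
      (hg : ∀ t, sem θ t ≠ 0 → sem θ' (g t) ≠ 0)
      (hg' : ∀ t, sem θ' t ≠ 0 → sem θ (g' t) ≠ 0)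
      (h : ∀ t, sem θ t ≠ 0 → OpClosure B Srt.st t (g t))
      (h' : ∀ t, sem θ' t ≠ 0 → OpClosure B Srt.st t (g' t)) :
      OpClosure B Srt.di θ θ'

namespace OpClosure

variable {B : CTerm S Srt.st → CTerm S Srt.st → Prop}

theorem di_iff {θ θ' : CTerm S Srt.di} :
    OpClosure B Srt.di θ θ' ↔
      SuppSim (OpClosure B Srt.st) (sem θ) (sem θ') ∧
        SuppSim (OpClosure B Srt.st) (sem θ') (sem θ) := by
  classical
  constructor
  · intro h
    cases h with
    | dist _ _ g g' hg hg' h h' =>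
      exact ⟨fun t ht => ⟨g t, hg t ht, h t ht⟩, fun t ht => ⟨g' t, hg' t ht, h' t ht⟩⟩
  · rintro ⟨h, h'⟩
    have h1 : ∀ t, ∃ t', sem θ t ≠ 0 → sem θ' t' ≠ 0 ∧ OpClosure B Srt.st t t' := fun t =>
      if ht : sem θ t ≠ 0 then (h t ht).imp fun _ hh _ => hh else ⟨t, fun hh => (ht hh).elim⟩
    have h2 : ∀ t, ∃ t', sem θ' t ≠ 0 → sem θ t' ≠ 0 ∧ OpClosure B Srt.st t t' := fun t =>
      if ht : sem θ' t ≠ 0 then (h' t ht).imp fun _ hh _ => hh else ⟨t, fun hh => (ht hh).elim⟩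
    choose g hg using h1
    choose g' hg' using h2
    exact .dist θ θ' g g' (fun t ht => (hg t ht).1) (fun t ht => (hg' t ht).1)
      (fun t ht => (hg t ht).2) (fun t ht => (hg' t ht).2)

theorem symm (hB : ∀ t t', B t t' → B t' t) {σ : Srt} {ξ ξ' : CTerm S σ}
    (h : OpClosure B σ ξ ξ') : OpClosure B σ ξ' ξ := by
  induction h with
  | base h => exact .base (hB _ _ h)
  | op f ξ ξ' _ ih => exact .op f ξ' ξ ih
  | dist θ θ' g g' hg hg' h h' _ _ => exact .dist θ' θ g' g hg' hg h' h

theorem refl (hB : ∀ t, B t t) : ∀ {σ : Srt} (ξ : CTerm S σ), OpClosure B σ ξ ξ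
  | Srt.st, t => .base (hB t)
  | Srt.di, _ => di_iff.2 ⟨fun t ht => ⟨t, ht, .base (hB t)⟩, fun t ht => ⟨t, ht, .base (hB t)⟩⟩

theorem op_inv {f : S.F} {ξ : ∀ i, CTerm S (S.argSort f i)} {t' : CTerm S Srt.st}
    (h : OpClosure B Srt.st (Term.op f ξ) t') :
    B (Term.op f ξ) t' ∨
      ∃ ξ', t' = Term.op f ξ' ∧ ∀ i, OpClosure B (S.argSort f i) (ξ i) (ξ' i) := by
  generalize hu : (Term.op f ξ : CTerm S Srt.st) = u at h
  cases h with
  | base h => exact .inl h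
  | op f' η η' h =>
    cases hu
    exact .inr ⟨η', rfl, h⟩

/-- A state position uses matching of supports. In a distribution position the argument is forced to
be `θ` itself, and is answered by `θ'`. -/
theorem exists_argDist {θ θ' : CTerm S Srt.di} (h : OpClosure B Srt.di θ θ') :
    ∀ (σ : Srt) (ξ : CTerm S σ), argDist θ (sem θ) σ ξ ≠ 0 →
      ∃ ξ', argDist θ' (sem θ') σ ξ' ≠ 0 ∧ OpClosure B σ ξ ξ'
  | Srt.st, ξ, hξ => (di_iff.1 h).1 ξ hξ
  | Srt.di, ξ, hξ => by
    obtain rfl : ξ = θ := by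
      by_contra hne
      exact hξ (PMF.pure_apply_of_ne _ _ hne)
    refine ⟨θ', ?_, h⟩
    show (PMF.pure θ') θ' ≠ 0
    simp

theorem suppSim_lift {f : S.F} {θ θ' : Fin (S.rank f) → CTerm S Srt.di}
    (h : ∀ i, OpClosure B Srt.di (θ i) (θ' i)) :
    SuppSim (OpClosure B Srt.st) (sem (Term.lift f θ)) (sem (Term.lift f θ')) := by
  intro t ht
  obtain ⟨ξ, rfl⟩ : ∃ ξ, t = Term.op f ξ := by
    by_contra hne
    exact ht (sem_lift_of_ne f θ t fun ξ hξ => hne ⟨ξ, hξ⟩)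
  rw [sem_lift_op, Finset.prod_ne_zero_iff] at ht
  choose ξ' h1 h2 using fun i => exists_argDist (h i) _ (ξ i) (ht i (Finset.mem_univ i))
  refine ⟨Term.op f ξ', ?_, .op f ξ ξ' h2⟩
  rw [sem_lift_op, Finset.prod_ne_zero_iff]
  exact fun i _ => h1 i

theorem suppSim_delta {hδ : S.hasDelta} {t t' : CTerm S Srt.st} (h : OpClosure B Srt.st t t') :
    SuppSim (OpClosure B Srt.st) (sem (Term.delta hδ t)) (sem (Term.delta hδ t')) := by
  intro u hu
  rw [sem_delta] at hu ⊢
  obtain rfl : u = t := by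
    by_contra hne
    exact hu (PMF.pure_apply_of_ne _ _ hne)
  exact ⟨t', by simp, h⟩

theorem sem_oplus_ne_zero {o : S.Oplus} {θ : S.idx o → CTerm S Srt.di} {t : CTerm S Srt.st} :
    sem (Term.oplus o θ) t ≠ 0 ↔ ∃ i, sem (θ i) t ≠ 0 := by
  rw [sem_oplus_apply, Ne, ENNReal.tsum_eq_zero]
  simp [S.weight_ne_zero]

theorem suppSim_oplus {o : S.Oplus} {θ θ' : S.idx o → CTerm S Srt.di}
    (h : ∀ i, OpClosure B Srt.di (θ i) (θ' i)) :
    SuppSim (OpClosure B Srt.st) (sem (Term.oplus o θ)) (sem (Term.oplus o θ')) := by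
  intro t ht
  obtain ⟨i, hi⟩ := sem_oplus_ne_zero.1 ht
  obtain ⟨t', h1, h2⟩ := (di_iff.1 (h i)).1 t hi
  exact ⟨t', sem_oplus_ne_zero.2 ⟨i, h1⟩, h2⟩

theorem lift (hB : ∀ t t', B t t' → B t' t) (f : S.F) {θ θ' : Fin (S.rank f) → CTerm S Srt.di}
    (h : ∀ i, OpClosure B Srt.di (θ i) (θ' i)) :
    OpClosure B Srt.di (Term.lift f θ) (Term.lift f θ') :=
  di_iff.2 ⟨suppSim_lift h, suppSim_lift fun i => (h i).symm hB⟩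

theorem delta (hB : ∀ t t', B t t' → B t' t) (hδ : S.hasDelta) {t t' : CTerm S Srt.st}
    (h : OpClosure B Srt.st t t') :
    OpClosure B Srt.di (Term.delta hδ t) (Term.delta hδ t') :=
  di_iff.2 ⟨suppSim_delta h, suppSim_delta (h.symm hB)⟩

theorem oplus (hB : ∀ t t', B t t' → B t' t) (o : S.Oplus) {θ θ' : S.idx o → CTerm S Srt.di}
    (h : ∀ i, OpClosure B Srt.di (θ i) (θ' i)) :
    OpClosure B Srt.di (Term.oplus o θ) (Term.oplus o θ') :=
  di_iff.2 ⟨suppSim_oplus h, suppSim_oplus fun i => (h i).symm hB⟩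

theorem subst (hB : ∀ t t', B t t' → B t' t) {X : Srt → Type v}
    {ρ ρ' : Subst S X (fun _ => Empty)} {σ : Srt} (ξ : Term S X σ)
    (h : ∀ ζ ∈ ξ.vars, OpClosure B ζ.1 (ρ ζ.1 ζ.2) (ρ' ζ.1 ζ.2)) :
    OpClosure B σ (ξ.subst ρ) (ξ.subst ρ') := by
  induction ξ with
  | var x =>
    simp only [Term.subst]
    exact h ⟨_, x⟩ (by simp [Term.vars])
  | op f ξ ih =>
    simp only [Term.subst]
    exact .op f _ _ fun i => ih i fun ζ hζ => h ζ (by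
      simp only [Term.vars, Set.mem_iUnion]; exact ⟨i, hζ⟩)
  | lift f θ ih =>
    simp only [Term.subst]
    exact lift hB f fun i => ih i fun ζ hζ => h ζ (by
      simp only [Term.vars, Set.mem_iUnion]; exact ⟨i, hζ⟩)
  | delta hδ t ih =>
    simp only [Term.subst]
    exact delta hB hδ (ih fun ζ hζ => h ζ (by simpa only [Term.vars] using hζ))
  | oplus o θ ih =>
    simp only [Term.subst]
    exact oplus hB o fun i => ih i fun ζ hζ => h ζ (by
      simp only [Term.vars, Set.mem_iUnion]; exact ⟨i, hζ⟩)

end OpClosure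

end Closure

theorem Term.subst_congr {S : Signature.{u}} {X : Srt → Type v} {X' : Srt → Type w}
    {ρ ρ' : Subst S X X'} {σ : Srt} (ξ : Term S X σ)
    (h : ∀ ζ ∈ ξ.vars, ρ ζ.1 ζ.2 = ρ' ζ.1 ζ.2) : ξ.subst ρ = ξ.subst ρ' := by
  induction ξ with
  | var x =>
    simp only [Term.subst]
    exact h ⟨_, x⟩ (by simp [Term.vars])
  | op f ξ ih =>
    simp only [Term.subst]
    exact congrArg _ (funext fun i => ih i fun ζ hζ => h ζ (by
      simp only [Term.vars, Set.mem_iUnion]; exact ⟨i, hζ⟩))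
  | lift f θ ih =>
    simp only [Term.subst]
    exact congrArg _ (funext fun i => ih i fun ζ hζ => h ζ (by
      simp only [Term.vars, Set.mem_iUnion]; exact ⟨i, hζ⟩))
  | delta hδ t ih =>
    simp only [Term.subst]
    exact congrArg _ (ih fun ζ hζ => h ζ (by simpa only [Term.vars] using hζ))
  | oplus o θ ih =>
    simp only [Term.subst]
    exact congrArg _ (funext fun i => ih i fun ζ hζ => h ζ (by
      simp only [Term.vars, Set.mem_iUnion]; exact ⟨i, hζ⟩))

/-! ## Choice along a well-founded relation -/

/-- If `Q a g` depends on `g` only below `a`, and can be satisfied at `a` whenever it is satisfied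
by `g` below `a`, then it is satisfied everywhere by some `g`. -/
theorem exists_forall_of_wellFounded {α : Type u} {β : α → Type v} {r : α → α → Prop}
    (wf : WellFounded r) (g₀ : ∀ a, β a) (Q : ∀ a, (∀ b, β b) → β a → Prop)
    (hloc : ∀ a g g', (∀ b, r b a → g b = g' b) → ∀ x, Q a g x → Q a g' x)
    (hex : ∀ a g, (∀ b, r b a → Q b g (g b)) → ∃ x, Q a g x) :
    ∃ g : ∀ a, β a, ∀ a, Q a g (g a) := by
  classical
  let ext : ∀ a, (∀ b, r b a → β b) → ∀ b, β b := fun a p b => if h : r b a then p b h else g₀ b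
  let F : ∀ a, (∀ b, r b a → β b) → β a := fun a p =>
    if h : ∃ x, Q a (ext a p) x then h.choose else g₀ a
  let g : ∀ a, β a := wf.fix F
  have hext : ∀ a b, r b a → ext a (fun b _ => g b) b = g b := fun a b h => dif_pos h
  refine ⟨g, fun a => ?_⟩
  induction a using wf.induction with
  | _ a ih =>
    -- The recursion at `a` sees `g` only below `a`, padded by `g₀`. Locality carries existence from
    -- `g` to the padded function and, at the end, the chosen value back to `g`.
    have hx : ∃ x, Q a (ext a fun b _ => g b) x :=
      (hex a g ih).imp fun x hx => hloc a _ _ (fun b hb => (hext a b hb).symm) x hx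
    have hg : g a = hx.choose := (wf.fix_eq F a).trans (dif_pos hx)
    rw [hg]
    exact hloc a _ _ (hext a) _ hx.choose_spec

/-! ## The least stable model as a least fixed point -/

section Stable

variable {S : Signature.{u}} {A : Type w} {X : Srt → Type v}

theorem PTSS.Provable.mono {P : PTSS S A X} {H H' : Set (CLiteral S A)} (hH : H ⊆ H')
    {χ : CLiteral S A} (h : P.Provable H χ) : P.Provable H' χ := by
  induction h with
  | hyp h => exact .hyp (hH h)
  | quant h => exact .quant h
  | rule r hr ρ hρ _ ih => exact .rule r hr ρ hρ ih

/-- The closed negative literals that hold in `Tr`. -/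
def negHolding (Tr : TRel S A) : Set (CLiteral S A) :=
  {φ | ∃ t a, (∀ θ, ¬ Tr t a θ) ∧ φ = .neg t a}

/-- Provability is monotone in the hypotheses, so all negative literals that hold may be assumed at
once. -/
theorem PTSS.supported_iff {P : PTSS S A X} {Tr : TRel S A} {t : CTerm S Srt.st} {a : A}
    {θ : CTerm S Srt.di} :
    P.Supported Tr t a θ ↔ P.Provable (negHolding Tr) (.pos t a θ) := by
  constructor
  · rintro ⟨N, h, hN⟩
    refine h.mono ?_
    rintro _ ⟨n, hn, rfl⟩
    exact ⟨n.1, n.2, hN n hn, rfl⟩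
  · intro h
    refine ⟨{n | ∀ θ, ¬ Tr n.1 n.2 θ}, h.mono ?_, fun n hn => hn⟩
    rintro _ ⟨t, a, hn, rfl⟩
    exact ⟨(t, a), hn, rfl⟩

theorem PTSS.supported_antitone (P : PTSS S A X) : Antitone (P.Supported (X := X)) := by
  rintro Tr Tr' h t a θ ⟨N, h1, h2⟩
  exact ⟨N, h1, fun n hn θ' hθ' => h2 n hn θ' (h _ _ _ hθ')⟩

/-- The monotone operator whose least fixed point consists of the certain transitions. -/
def PTSS.supportedTwice (P : PTSS S A X) : TRel S A →o TRel S A :=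
  ⟨fun Tr => P.Supported (P.Supported Tr), fun _ _ h =>
    P.supported_antitone (P.supported_antitone h)⟩

theorem PTSS.isStable_lfp (P : PTSS S A X) :
    P.IsStable P.supportedTwice.lfp (P.Supported P.supportedTwice.lfp) := by
  have hfix : P.Supported (P.Supported P.supportedTwice.lfp) = P.supportedTwice.lfp :=
    P.supportedTwice.map_lfp
  refine ⟨?_, fun t a θ => by rw [hfix], fun t a θ => Iff.rfl⟩
  -- Applying `Supported` to a fixed point of its square gives another fixed point, which lies above
  -- the least one.
  refine P.supportedTwice.lfp_le (a := P.Supported P.supportedTwice.lfp) ?_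
  show P.Supported (P.Supported (P.Supported P.supportedTwice.lfp)) ≤ _
  rw [hfix]

/-- The certain part of any stable model is a fixed point of `supportedTwice`, so that of the least
model is the least fixed point. Completeness identifies certain with possible, which makes it a
fixed point of `Supported` itself. -/
theorem PTSS.Complete.tr_eq_lfp {P : PTSS S A X} (h : P.Complete) :
    P.tr = P.supportedTwice.lfp ∧ P.Supported P.tr = P.tr := by
  have key : ∀ CT PT, P.IsLeastStable CT PT → CT = P.supportedTwice.lfp := by
    intro CT PT h
    refine le_antisymm (h.least _ _ P.isStable_lfp).1 (P.supportedTwice.lfp_le ?_)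
    have h1 : P.Supported CT = PT := by
      ext t a θ; exact (h.stable.possible_iff t a θ).symm
    have h2 : P.Supported PT = CT := by
      ext t a θ; exact (h.stable.certain_iff t a θ).symm
    show P.Supported (P.Supported CT) ≤ CT
    rw [h1, h2]
  obtain ⟨CT, PT, hl, rfl⟩ := h
  have htr : P.tr = CT := by
    ext t a θ
    constructor
    · rintro ⟨CT', PT', hl', h⟩
      rwa [key _ _ hl, ← key _ _ hl']
    · exact fun h => ⟨CT, CT, hl, h⟩
  refine ⟨htr.trans (key _ _ hl), ?_⟩
  rw [htr]
  ext t a θ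
  exact (hl.stable.certain_iff t a θ).symm

end Stable

/-! ## Transfer of derivations along the closure -/

section Transfer

variable {S : Signature.{u}} {A : Type w} {X : Srt → Type v}
  {B : CTerm S Srt.st → CTerm S Srt.st → Prop}

/-- The condition on the value `x` of the variable `ζ` under the new substitution `g`. -/
structure Rule.GoodValue (r : Rule S A X) (B : CTerm S Srt.st → CTerm S Srt.st → Prop)
    (Tr : TRel S A) (V : Set (Σ σ : Srt, X σ)) (ρ ρ₀ : ∀ ζ : (Σ σ : Srt, X σ), CTerm S ζ.1)
    (ζ : Σ σ : Srt, X σ) (g : ∀ ζ : (Σ σ : Srt, X σ), CTerm S ζ.1) (x : CTerm S ζ.1) : Prop where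
  rel : OpClosure B ζ.1 (ρ ζ) x
  source : ζ ∈ V → x = ρ₀ ζ
  -- Here and in `quant`, `g` is evaluated only at predecessors of `ζ` in the dependency graph; the
  -- value at `ζ` itself is the candidate `x`.
  pos : ∀ t a μ, Literal.pos t a (Term.var μ) ∈ r.prem → ∀ h : ζ = ⟨Srt.di, μ⟩,
    Tr (t.subst fun σ x => g ⟨σ, x⟩) a (cast (congrArg (fun ζ => CTerm S ζ.1) h) x)
  quant : ∀ θ T c q y, Literal.quant θ T c q ∈ r.prem → Term.var y ∈ T →
    ∀ h : ζ = ⟨Srt.st, y⟩,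
      sem (θ.subst fun σ x => g ⟨σ, x⟩) (cast (congrArg (fun ζ => CTerm S ζ.1) h) x) ≠ 0

theorem Rule.Scheme.pos_inv {r : Rule S A X} {V : Set (Σ σ : Srt, X σ)} (s : r.Scheme V)
    {t : Term S X Srt.st} {a : A} {θ : Term S X Srt.di} (h : Literal.pos t a θ ∈ r.prem) :
    ∃ m, ∃ z ∈ s.diag, t = (s.t m).subst (ZVar.inst S z) ∧ a = s.a m ∧
      θ = Term.var (s.mu m z) := by
  rw [s.prem_eq] at h
  rcases h with (⟨m, z, hz, h⟩ | ⟨n, _, z, _, h⟩) | ⟨l, k, _, h⟩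
  · injection h with h1 h2 h3
    exact ⟨m, z, hz, h1, h2, h3⟩
  · cases h
  · cases h

theorem Rule.Scheme.quant_inv {r : Rule S A X} {V : Set (Σ σ : Srt, X σ)} (s : r.Scheme V)
    {θ : Term S X Srt.di} {T : Set (Term S X Srt.st)} {c : Cmp} {q : unitInterval}
    (h : Literal.quant θ T c q ∈ r.prem) :
    ∃ l, θ = s.theta l ∧ T = Term.var '' s.Y l ∧ (c = Cmp.gt ∨ c = Cmp.ge) := by
  rw [s.prem_eq] at h
  rcases h with (⟨m, z, hz, h⟩ | ⟨n, _, z, _, h⟩) | ⟨l, k, hk, h⟩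
  · cases h
  · cases h
  · injection h with h1 h2 h3
    exact ⟨l, h1, h2, h3 ▸ s.bounds_lower l k hk⟩

/-- The substitution `ρ₀` on the source variables `V` extends to a substitution that is related to
`ρ` and satisfies the positive and the quantitative premises of `r`. -/
theorem Rule.Scheme.exists_subst (hrefl : ∀ t, B t t) (hsymm : ∀ t t', B t t' → B t' t)
    {r : Rule S A X} (hwf : WellFounded r.Dep) {V : Set (Σ σ : Srt, X σ)} (s : r.Scheme V)
    {Tr : TRel S A} (ρ ρ₀ : ∀ ζ : (Σ σ : Srt, X σ), CTerm S ζ.1)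
    (hρ : r.Proper fun σ x => ρ ⟨σ, x⟩) (h₀ : ∀ ζ ∈ V, OpClosure B ζ.1 (ρ ζ) (ρ₀ ζ))
    (hpos : ∀ t a θ, Literal.pos t a θ ∈ r.prem →
      ∀ t', OpClosure B Srt.st (t.subst fun σ x => ρ ⟨σ, x⟩) t' →
        ∃ θ', Tr t' a θ' ∧ OpClosure B Srt.di (θ.subst fun σ x => ρ ⟨σ, x⟩) θ') :
    ∃ g : ∀ ζ : (Σ σ : Srt, X σ), CTerm S ζ.1, ∀ ζ, r.GoodValue B Tr V ρ ρ₀ ζ g (g ζ) := by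
  classical
  refine exists_forall_of_wellFounded hwf ρ (r.GoodValue B Tr V ρ ρ₀) ?_ ?_
  · intro ζ g g' hgg' x hx
    refine ⟨hx.rel, hx.source, ?_, ?_⟩
    · intro t a μ ht h
      rw [← Term.subst_congr (ρ := fun σ x => g ⟨σ, x⟩) t
        fun ζ hζ => hgg' ζ (h ▸ .pos ht hζ)]
      exact hx.pos t a μ ht h
    · intro θ T c q y hθ hy h
      rw [← Term.subst_congr (ρ := fun σ x => g ⟨σ, x⟩) θ
        fun ζ hζ => hgg' ζ (h ▸ .quant hθ hy hζ)]
      exact hx.quant θ T c q y hθ hy h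
  · intro ζ g hg
    have hposV : ∀ t a μ, Literal.pos t a (Term.var μ) ∈ r.prem →
        (⟨Srt.di, μ⟩ : Σ σ : Srt, X σ) ∉ V := by
      intro t a μ h
      obtain ⟨m, z, hz, -, -, h⟩ := s.pos_inv h
      injection h with h1 h2
      rw [h2]
      exact s.mu_not_source m z hz
    have hquant : ∀ θ T c q y, Literal.quant θ T c q ∈ r.prem → Term.var y ∈ T →
        ∃ l, θ = s.theta l ∧ y ∈ s.Y l := by
      intro θ T c q y h hy
      obtain ⟨l, h1, rfl, -⟩ := s.quant_inv h
      obtain ⟨y', hy', h2⟩ := hy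
      injection h2 with h3 h4
      exact ⟨l, h1, h4 ▸ hy'⟩
    have hquantV : ∀ θ T c q y, Literal.quant θ T c q ∈ r.prem → Term.var y ∈ T →
        (⟨Srt.st, y⟩ : Σ σ : Srt, X σ) ∉ V := by
      intro θ T c q y h hy
      obtain ⟨l, -, hyl⟩ := hquant θ T c q y h hy
      exact s.Y_not_source l y hyl
    by_cases hV : ζ ∈ V
    · refine ⟨ρ₀ ζ, h₀ ζ hV, fun _ => rfl, ?_, ?_⟩
      · intro t a μ ht h
        exact (hposV t a μ ht (h ▸ hV)).elim
      · intro θ T c q y hθ hy h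
        exact (hquantV θ T c q y hθ hy (h ▸ hV)).elim
    by_cases hP : ∃ t a μ, Literal.pos t a (Term.var μ) ∈ r.prem ∧ ζ = ⟨Srt.di, μ⟩
    · obtain ⟨t, a, μ, ht, rfl⟩ := hP
      obtain ⟨θ', h1, h2⟩ := hpos t a _ ht (t.subst fun σ x => g ⟨σ, x⟩)
        (OpClosure.subst hsymm t fun ζ hζ => (hg ζ (.pos ht hζ)).rel)
      simp only [Term.subst] at h2
      refine ⟨θ', h2, fun h => (hV h).elim, ?_, ?_⟩
      · rintro t' a' μ' ht' h
        obtain rfl : μ = μ' := by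
          injection h
        obtain ⟨m, z, hz, rfl, rfl, e⟩ := s.pos_inv ht
        obtain ⟨m', z', hz', rfl, rfl, e'⟩ := s.pos_inv ht'
        have hmu : s.mu m z = s.mu m' z' := by
          injection e.symm.trans e'
        -- A variable is the target of only one positive premise, so the chosen value meets every
        -- demand on it.
        obtain ⟨e1, e2⟩ := s.mu_inj m z hz m' z' hz' hmu
        rw [← e1, ← e2]
        exact h1
      · rintro θ T c q y hθ hy h
        cases h
    by_cases hQ : ∃ θ T c q y, Literal.quant θ T c q ∈ r.prem ∧ Term.var y ∈ T ∧
        ζ = ⟨Srt.st, y⟩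
    · obtain ⟨θ, T, c, q, y, hθ, hy, rfl⟩ := hQ
      have hrel : OpClosure B Srt.di (θ.subst fun σ x => ρ ⟨σ, x⟩)
          (θ.subst fun σ x => g ⟨σ, x⟩) :=
        OpClosure.subst hsymm θ fun ζ hζ => (hg ζ (.quant hθ hy hζ)).rel
      have hpr := (hρ θ T c q hθ _ hy).ne'
      simp only [Term.subst] at hpr
      -- Properness of `ρ` puts the old value of `y` in the support of the old instance of `θ`; its
      -- match in the new support is the new value.
      obtain ⟨t', h1, h2⟩ := (OpClosure.di_iff.1 hrel).1 _ hpr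
      refine ⟨t', h2, fun h => (hV h).elim, ?_, ?_⟩
      · rintro t' a' μ' ht' h
        cases h
      · rintro θ' T' c' q' y' hθ' hy' h
        obtain rfl : y = y' := by
          injection h
        obtain ⟨l, rfl, hl⟩ := hquant _ _ _ _ _ hθ hy
        obtain ⟨l', rfl, hl'⟩ := hquant _ _ _ _ _ hθ' hy'
        -- Disjointness of the sets `Y_l` leaves a single `θ_l` constraining `y`.
        obtain rfl : l = l' := by
          by_contra hne
          exact Set.disjoint_left.1 (s.Y_disjoint l l' hne) hl hl'
        exact h1
    exact ⟨ρ ζ, OpClosure.refl hrefl _, fun h => (hV h).elim,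
      fun t a μ ht h => (hP ⟨t, a, μ, ht, h⟩).elim,
      fun θ T c q y hθ hy h => (hQ ⟨θ, T, c, q, y, hθ, hy, h⟩).elim⟩

theorem provable_neg_inv {P : PTSS S A X} {Tr : TRel S A} {t : CTerm S Srt.st} {a : A}
    (h : P.Provable (negHolding Tr) (.neg t a)) : ∀ θ, ¬ Tr t a θ := by
  cases h with
  | hyp h =>
    obtain ⟨t', a', h, e⟩ := h
    cases e
    exact h

/-- An instance of `r` can be transferred to every term that is obtained from its source by a
related instantiation of the source variables. -/
theorem Rule.Scheme.transfer (hrefl : ∀ t, B t t) (hsymm : ∀ t t', B t t' → B t' t)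
    {P : PTSS S A X} {r : Rule S A X} (hr : r ∈ P.rules) (hwf : WellFounded r.Dep)
    (hq : ∀ θ T c q, Literal.quant θ T c q ∈ r.prem → q = 0)
    {V : Set (Σ σ : Srt, X σ)} (s : r.Scheme V) (hV : r.src.vars = V) {Tr Tr' : TRel S A}
    (hneg : ∀ u u' b, OpClosure B Srt.st u u' → (∀ θ, ¬ Tr u b θ) → ∀ θ, ¬ Tr' u' b θ)
    (ρ ρ₀ : ∀ ζ : (Σ σ : Srt, X σ), CTerm S ζ.1)
    (hρ : r.Proper fun σ x => ρ ⟨σ, x⟩) (h₀ : ∀ ζ ∈ V, OpClosure B ζ.1 (ρ ζ) (ρ₀ ζ))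
    (hprem : ∀ φ ∈ r.prem, P.Provable (negHolding Tr) (φ.close fun σ x => ρ ⟨σ, x⟩))
    (hpos : ∀ t a θ, Literal.pos t a θ ∈ r.prem →
      ∀ t', OpClosure B Srt.st (t.subst fun σ x => ρ ⟨σ, x⟩) t' →
        ∃ θ', P.Supported Tr' t' a θ' ∧
          OpClosure B Srt.di (θ.subst fun σ x => ρ ⟨σ, x⟩) θ') :
    ∃ θ', P.Supported Tr' (r.src.subst fun σ x => ρ₀ ⟨σ, x⟩) r.act θ' ∧
      OpClosure B Srt.di (r.tgt.subst fun σ x => ρ ⟨σ, x⟩) θ' := by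
  obtain ⟨g, hg⟩ := s.exists_subst hrefl hsymm hwf ρ ρ₀ hρ h₀ hpos
  have hproper : r.Proper fun σ x => g ⟨σ, x⟩ := by
    intro θ T c q h t ht
    obtain ⟨l, -, rfl, -⟩ := s.quant_inv h
    obtain ⟨y, hy, rfl⟩ := ht
    simp only [Term.subst]
    exact pos_iff_ne_zero.2 ((hg ⟨Srt.st, y⟩).quant _ _ _ _ y h ⟨y, hy, rfl⟩ rfl)
  refine ⟨r.tgt.subst fun σ x => g ⟨σ, x⟩, ?_,
    OpClosure.subst hsymm _ fun ζ _ => (hg ζ).rel⟩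
  rw [PTSS.supported_iff, Term.subst_congr (ρ' := fun σ x => g ⟨σ, x⟩) r.src
    fun ζ hζ => ((hg ζ).source (hV ▸ hζ)).symm]
  refine .rule r hr _ hproper fun φ hφ => ?_
  cases φ with
  | pos t a θ =>
    obtain ⟨m, z, hz, -, -, rfl⟩ := s.pos_inv hφ
    have := (hg _).pos t a _ hφ rfl
    rw [PTSS.supported_iff] at this
    simpa only [Literal.close, Term.subst, cast_eq] using this
  | neg t a =>
    have h := provable_neg_inv (hprem _ hφ)
    exact .hyp ⟨_, a, hneg _ _ a (OpClosure.subst hsymm t fun ζ _ => (hg ζ).rel) h, rfl⟩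
  | quant θ T c q =>
    obtain rfl := hq _ _ _ _ hφ
    obtain ⟨l, rfl, rfl, hc⟩ := s.quant_inv hφ
    refine .quant ?_
    have h0 : ENNReal.ofReal ((0 : unitInterval) : ℝ) = 0 := by simp
    rw [h0]
    rcases hc with rfl | rfl
    -- With bound 0, one point of positive probability is enough, and properness gives it for any
    -- element of `Y_l`.
    · obtain ⟨y, hy⟩ := (s.Y_infinite l).nonempty
      refine (prob_pos_iff _ _).2 ⟨_, ⟨Term.var y, ⟨y, hy, rfl⟩, rfl⟩, ?_⟩
      exact (hproper _ _ _ _ hφ _ ⟨y, hy, rfl⟩).ne'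
    · exact zero_le

/-- Values at pairwise different variables extend to all variables. -/
theorem exists_extend {ι : Type*} {β : ι → Srt} {ζ : ∀ i, X (β i)}
    (hinj : Function.Injective fun i => (⟨β i, ζ i⟩ : Σ σ : Srt, X σ))
    (ρ : ∀ ζ : (Σ σ : Srt, X σ), CTerm S ζ.1) (ξ : ∀ i, CTerm S (β i)) :
    ∃ ρ₀ : ∀ ζ : (Σ σ : Srt, X σ), CTerm S ζ.1, ∀ i, ρ₀ ⟨β i, ζ i⟩ = ξ i := by
  have : ∀ p : (Σ σ : Srt, X σ), ∃ x : CTerm S p.1,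
      ∀ i, ∀ h : (⟨β i, ζ i⟩ : Σ σ : Srt, X σ) = p, x = h ▸ ξ i := by
    intro p
    by_cases hp : ∃ i, (⟨β i, ζ i⟩ : Σ σ : Srt, X σ) = p
    · obtain ⟨i, rfl⟩ := hp
      refine ⟨ξ i, fun j h => ?_⟩
      obtain rfl := hinj h
      rfl
    · exact ⟨ρ p, fun i h => (hp ⟨i, h⟩).elim⟩
  choose ρ₀ h using this
  exact ⟨ρ₀, fun i => h _ i rfl⟩

/-- Two relations `Tr`, `Tr'` are kept apart so that the lemma can link different stages of the
fixed point iteration. The hypothesis `hneg` supplies the negative premises, and `hbase` the pairs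
that are related by `B` directly. -/
theorem PTSS.supported_transfer (hrefl : ∀ t, B t t) (hsymm : ∀ t t', B t t' → B t' t)
    {P : PTSS S A X} (hwf : P.WellFoundedRules) (hformat : P.InAbstractedFormat)
    {Tr Tr' : TRel S A}
    (hneg : ∀ u u' b, OpClosure B Srt.st u u' → (∀ θ, ¬ Tr u b θ) → ∀ θ, ¬ Tr' u' b θ)
    (hbase : ∀ t t' a θ, B t t' → P.Supported Tr t a θ →
      ∃ θ', P.Supported Tr' t' a θ' ∧ OpClosure B Srt.di θ θ')
    {t t' : CTerm S Srt.st} {a : A} {θ : CTerm S Srt.di} (htt' : OpClosure B Srt.st t t')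
    (h : P.Supported Tr t a θ) :
    ∃ θ', P.Supported Tr' t' a θ' ∧ OpClosure B Srt.di θ θ' := by
  rw [PTSS.supported_iff] at h
  generalize hχ : (Literal.pos t a θ : CLiteral S A) = χ at h
  induction h generalizing t t' a θ with
  | hyp h =>
    obtain ⟨u, b, -, rfl⟩ := h
    cases hχ
  | quant h => cases hχ
  | rule r hr ρ hρ hprem ih =>
    injection hχ with e1 e2 e3
    subst e1 e2 e3
    have hpos : ∀ t a θ, Literal.pos t a θ ∈ r.prem →
        ∀ t', OpClosure B Srt.st (t.subst ρ) t' →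
          ∃ θ', P.Supported Tr' t' a θ' ∧ OpClosure B Srt.di (θ.subst ρ) θ' :=
      fun t a θ hm t' ht' => ih _ hm ht' rfl
    rcases hformat.1 r hr with ⟨f, ζ, hinj, hsrc, ⟨s⟩⟩ | ⟨x, hsrc, ⟨s⟩⟩
    · have hsub : r.src.subst ρ = Term.op f fun i => ρ _ (ζ i) := by
        rw [hsrc]
        simp only [Term.subst]
      rw [hsub] at htt'
      -- A pair in `B` need not share its head operator, so the rule cannot be reapplied and the
      -- whole transition is transferred by `hbase`. Otherwise the source variables are reassigned
      -- to the arguments `ξ'`.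
      rcases htt'.op_inv with hb | ⟨ξ', rfl, hξ⟩
      · rw [← hsub] at hb
        exact hbase _ _ _ _ hb (PTSS.supported_iff.2 (.rule r hr ρ hρ hprem))
      · obtain ⟨ρ₀, hρ₀⟩ := exists_extend hinj (fun ζ => ρ ζ.1 ζ.2) ξ'
        have := s.transfer hrefl hsymm hr (hwf r hr) (hformat.2 r hr)
          (by rw [hsrc]; ext p; simp [Term.vars, eq_comm]) hneg (fun ζ => ρ ζ.1 ζ.2) ρ₀ hρ
          (by rintro _ ⟨i, rfl⟩; simp only [hρ₀]; exact hξ i) hprem hpos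
        rw [hsrc] at this
        simpa only [Term.subst, hρ₀] using this
    · have hsub : r.src.subst ρ = ρ _ x := by
        rw [hsrc]
        simp only [Term.subst]
      rw [hsub] at htt'
      obtain ⟨ρ₀, hρ₀⟩ := exists_extend (ι := Unit) (β := fun _ => Srt.st) (ζ := fun _ => x)
        (fun _ _ _ => rfl) (fun ζ => ρ ζ.1 ζ.2) fun _ => t'
      have := s.transfer hrefl hsymm hr (hwf r hr) (hformat.2 r hr)
        (by rw [hsrc]; simp [Term.vars]) hneg (fun ζ => ρ ζ.1 ζ.2) ρ₀ hρ
        (by rintro _ rfl; rw [hρ₀ ()]; exact htt') hprem hpos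
      rw [hsrc] at this
      simpa only [Term.subst, hρ₀ ()] using this

end Transfer

/-! ## The congruence theorem -/

section Congruence

variable {S : Signature.{u}} {A : Type w} {X : Srt → Type v} {P : PTSS S A X}

theorem PTSS.absBisim_equivalence (P : PTSS S A X) : Equivalence P.absBisim :=
  absBisimilar_equivalence

theorem PTSS.tr_transfer_of_absBisim {t t' : CTerm S Srt.st} {a : A} {θ : CTerm S Srt.di}
    (h : P.absBisim t t') (hθ : P.tr t a θ) :
    ∃ θ', P.tr t' a θ' ∧ OpClosure P.absBisim Srt.di θ θ' := by
  obtain ⟨_, ⟨θ', h1, rfl⟩, h2⟩ := isAbsBisimulation_absBisimilar.2 _ _ a _ h ⟨θ, hθ, rfl⟩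
  exact ⟨θ', h1, OpClosure.di_iff.2
    ⟨(h2.suppSim P.absBisim_equivalence).mono fun _ _ => .base,
      (h2.symm.suppSim P.absBisim_equivalence).mono fun _ _ => .base⟩⟩

theorem PTSS.tr_transfer (hcomplete : P.Complete) (hwf : P.WellFoundedRules)
    (hformat : P.InAbstractedFormat) {t t' : CTerm S Srt.st} {a : A} {θ : CTerm S Srt.di}
    (htt' : OpClosure P.absBisim Srt.st t t') (h : P.tr t a θ) :
    ∃ θ', P.tr t' a θ' ∧ OpClosure P.absBisim Srt.di θ θ' := by
  obtain ⟨hlfp, hsupp⟩ := hcomplete.tr_eq_lfp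
  have hrefl : ∀ t, P.absBisim t t := P.absBisim_equivalence.refl
  have hsymm : ∀ t t', P.absBisim t t' → P.absBisim t' t :=
    fun _ _ => P.absBisim_equivalence.symm
  -- The answering transition is sought in the full relation `P.tr`, not in `C`; this makes the
  -- property stable under suprema.
  let p : TRel S A → Prop := fun C => ∀ t t' a θ, OpClosure P.absBisim Srt.st t t' → C t a θ →
    ∃ θ', P.tr t' a θ' ∧ OpClosure P.absBisim Srt.di θ θ'
  suffices hp : p P.supportedTwice.lfp from hp t t' a θ htt' (hlfp ▸ h)
  refine OrderHom.lfp_induction _ (fun C hC hle => ?_) fun s hs => ?_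
  · rw [← hlfp] at hle
    have hle1 : P.tr ≤ P.Supported C := hsupp ▸ P.supported_antitone hle
    have hle2 : P.Supported (P.Supported C) ≤ P.tr := hsupp ▸ P.supported_antitone hle1
    -- The dual half of the step: `P.tr` transfers into the overestimate `Supported C`. A transition
    -- of `C` that violated a negative premise would transfer back to `P.tr` by the induction
    -- hypothesis. This half in turn justifies the negative premises when `Supported (Supported C)`
    -- is transferred into `P.tr`.
    have hpossible : ∀ t t' a θ, OpClosure P.absBisim Srt.st t t' → P.tr t a θ →
        ∃ θ', P.Supported C t' a θ' ∧ OpClosure P.absBisim Srt.di θ θ' := by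
      intro t t' a θ htt' h
      rw [← hsupp] at h
      refine PTSS.supported_transfer hrefl hsymm hwf hformat ?_ ?_ htt' h
      · intro u u' b huu' hn θ hθ
        obtain ⟨θ', h', -⟩ := hC u' u b θ (huu'.symm hsymm) hθ
        exact hn θ' h'
      · intro t t' a θ hb h
        rw [hsupp] at h
        exact (PTSS.tr_transfer_of_absBisim hb h).imp fun θ' h => ⟨hle1 _ _ _ h.1, h.2⟩
    intro t t' a θ htt' h
    rw [← hsupp]
    refine PTSS.supported_transfer hrefl hsymm hwf hformat ?_ ?_ htt' h
    · intro u u' b huu' hn θ hθ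
      obtain ⟨θ', h', -⟩ := hpossible u' u b θ (huu'.symm hsymm) hθ
      exact hn θ' h'
    · intro t t' a θ hb h
      rw [hsupp]
      exact PTSS.tr_transfer_of_absBisim hb (hle2 _ _ _ h)
  · intro t t' a θ htt' h
    simp only [sSup_apply, iSup_apply, iSup_Prop_eq] at h
    obtain ⟨⟨C, hC⟩, h⟩ := h
    exact hs C hC t t' a θ htt' h

/-- The closure is itself a bisimulation: matching of supports implies `AbsLift` for any relation,
so no transitivity is needed. -/
theorem PTSS.absBisim_of_opClosure (hcomplete : P.Complete) (hwf : P.WellFoundedRules)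
    (hformat : P.InAbstractedFormat) {t t' : CTerm S Srt.st}
    (h : OpClosure P.absBisim Srt.st t t') : P.absBisim t t' := by
  refine ⟨OpClosure P.absBisim Srt.st,
    ⟨fun _ _ => OpClosure.symm fun _ _ => P.absBisim_equivalence.symm, ?_⟩, h⟩
  rintro t t' a _ htt' ⟨θ, hθ, rfl⟩
  obtain ⟨θ', h1, h2⟩ := PTSS.tr_transfer hcomplete hwf hformat htt' hθ
  obtain ⟨h3, h4⟩ := OpClosure.di_iff.1 h2
  exact ⟨sem θ', ⟨θ', h1, rfl⟩, h3.absLift h4⟩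

theorem PTSS.sortRel_absBisim_iff (hcomplete : P.Complete) (hwf : P.WellFoundedRules)
    (hformat : P.InAbstractedFormat) :
    ∀ (σ : Srt) (ξ ξ' : CTerm S σ), SortRel P.absBisim σ ξ ξ' ↔ OpClosure P.absBisim σ ξ ξ'
  | Srt.st, _, _ => ⟨.base, PTSS.absBisim_of_opClosure hcomplete hwf hformat⟩
  | Srt.di, θ, θ' => by
    have hsub : ∀ t t', OpClosure P.absBisim Srt.st t t' → P.absBisim t t' :=
      fun _ _ => PTSS.absBisim_of_opClosure hcomplete hwf hformat
    constructor
    · intro (h : AbsLift P.absBisim (sem θ) (sem θ'))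
      exact OpClosure.di_iff.2
        ⟨(h.suppSim P.absBisim_equivalence).mono fun _ _ => .base,
          (h.symm.suppSim P.absBisim_equivalence).mono fun _ _ => .base⟩
    · intro h
      obtain ⟨h1, h2⟩ := OpClosure.di_iff.1 h
      exact (h1.mono hsub).absLift (h2.mono hsub)

end Congruence

end SOS

theorem mainTheorem1 {S : SOS.Signature} {A : Type*} {X : SOS.Srt → Type*}
    [∀ σ, Infinite (X σ)] (P : SOS.PTSS S A X)
    (hcomplete : P.Complete) (hwf : P.WellFoundedRules) (hformat : P.InAbstractedFormat) :
    SOS.IsCongruence P.absBisim := by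
  have key := SOS.PTSS.sortRel_absBisim_iff hcomplete hwf hformat
  have hsymm : ∀ t t', P.absBisim t t' → P.absBisim t' t :=
    fun _ _ => P.absBisim_equivalence.symm
  exact {
    equiv := P.absBisim_equivalence
    op := fun f ξ ξ' h => (key SOS.Srt.st _ _).2 (.op f ξ ξ' fun i => (key _ _ _).1 (h i))
    lift := fun f θ θ' h =>
      (key SOS.Srt.di _ _).2 (SOS.OpClosure.lift hsymm f fun i => (key _ _ _).1 (h i))
    delta := fun hδ t t' h =>
      (key SOS.Srt.di _ _).2 (SOS.OpClosure.delta hsymm hδ (.base h))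
    oplus := fun o θ θ' h =>
      (key SOS.Srt.di _ _).2 (SOS.OpClosure.oplus hsymm o fun i => (key _ _ _).1 (h i)) }
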